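/- Let $N\ge 1$, $m\ge 0$, and let $\mathcal G$ be a connected undirected weighted graph on the nodes $1,\dots,N$ without self-loops, with weights $a_{ij}=a_{ji}\ge 0$, $a_{ii}=0$, and $a_{ij}>0$ if and only if $i$ and $j$ are joined by an edge. Let $f_1,\dots,f_N:\mathbb R^m\to\mathbb R$ be differentiable and strictly convex, and suppose that $\sum_{i=1}^N f_i$ attains its minimum over $\mathbb R^m$, at the (necessarily unique) point $y^*$. Consider, for $t\ge 0$ and $i=1,\dots,N$, the dynamics $$\dot z_i=-\nabla f_i(z_i)-\sum_{j=1}^N a_{ij}(\lambda_i-\lambda_j),\qquad \dot\lambda_i=\sum_{j=1}^N a_{ij}(z_i-z_j),\qquad z_i,\lambda_i\in\mathbb R^m.$$ Then for every initial condition $(z_i(0),\lambda_i(0))_{i=1}^N$ there is a solution on $[0,\infty)$, and every solution on $[0,\infty)$ is bounded (in all $z_i$ and $\lambda_i$) and satisfies $\lim_{t\to\infty}\|z_i(t)-y^*\|=0$ for $i=1,\dots,N$. If moreover there are constants $\omega,\vartheta>0$ such that every $f_i$ is $\omega$-strongly convex and every $\nabla f_i$ is $\vartheta$-Lipschitz,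 then the convergence is exponential: there is a rate $\gamma>0$ such that for every solution on $[0,\infty)$ there is a constant $C$ with $\|z_i(t)-y^*\|\le C e^{-\gamma t}$ for all $t\ge 0$ and $i=1,\dots,N$. -/

import Mathlib

open Filter Topology
open scoped NNReal

/-- A weighted undirected graph on `V`: a simple graph (no self-loops) with a symmetric matrix of
nonnegative weights, where `0 < a i j` exactly when `i` and `j` are joined by an edge.
In particular `a i i = 0`. -/
structure WeightedGraph (V : Type*) where
  graph : SimpleGraph V
  a : Matrix V V ℝ
  symm : ∀ i j, a i j = a j i
  nonneg : ∀ i j, 0 ≤ a i j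
  pos_iff_adj : ∀ i j, 0 < a i j ↔ graph.Adj i j

/-- `(z, lam)` is a (forward complete) trajectory, on the time interval `[0, ∞)`, of
`z_i' = -∇ f_i(z_i) - ∑ j, a_ij (lam_i - lam_j)`, `lam_i' = ∑ j, a_ij (z_i - z_j)`.
At `t = 0` the derivative is the right derivative. -/
structure IsPrimalDualTrajectory {N m : ℕ} (G : WeightedGraph (Fin N))
    (f : Fin N → EuclideanSpace ℝ (Fin m) → ℝ)
    (z lam : ℝ → Fin N → EuclideanSpace ℝ (Fin m)) : Prop where
  primal : ∀ t : ℝ, 0 ≤ t → ∀ i, HasDerivWithinAt (fun s => z s i)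
    (-gradient (f i) (z t i) - ∑ j, G.a i j • (lam t i - lam t j)) (Set.Ici 0) t
  dual : ∀ t : ℝ, 0 ≤ t → ∀ i, HasDerivWithinAt (fun s => lam s i)
    (∑ j, G.a i j • (z t i - z t j)) (Set.Ici 0) t

/-! Stacking the nodes gives a saddle flow `z' = -g z - L l`, `l' = L z`, with `g` the stacked
gradient and `L` the symmetric Laplacian. At a minimizer the gradients sum to zero, and zero-sum
vectors form the range of `L`, so the repeated minimizer `zs` has a dual partner `ls`
(`WeightedGraph.exists_equilibrium`). The coupling through `L` is skew: in the derivative of `‖z -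
zs‖² + ‖l - ls‖²` it cancels, leaving `-2⟪g z - g zs, z - zs⟫`. This bounds the trajectory, and
strict monotonicity of `g` with bounded velocity forces `z → zs` (`tendsto_of_lyapunov`). The
gradients are continuous but need not be locally Lipschitz, so existence comes from monotonicity:
Euler polygons for the dissipative field are Cauchy (`exists_trajectory_of_monotone`). Under strong
convexity and Lipschitz gradients, a small cross term added to the energy makes the relevant dual
error decay too (`saddle_trajectory_exp_decay`). -/

theorem le_add_mul_of_deriv_right_le {f f' : ℝ → ℝ} {a b C : ℝ}
    (hf : ContinuousOn f (Set.Icc a b))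
    (hf' : ∀ x ∈ Set.Ico a b, HasDerivWithinAt f (f' x) (Set.Ici x) x)
    (bound : ∀ x ∈ Set.Ico a b, f' x ≤ C) {x : ℝ} (hx : x ∈ Set.Icc a b) :
    f x ≤ f a + C * (x - a) := by
  refine image_le_of_deriv_right_le_deriv_boundary (B := fun x => f a + C * (x - a))
    (B' := fun _ => C) hf hf' (by simp) (by fun_prop) (fun y _ => ?_) bound hx
  simpa using ((((hasDerivAt_id y).sub_const a).const_mul C).const_add (f a)).hasDerivWithinAt

/-! ### Global solutions for continuous dissipative vector fields. -/

section ODE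

variable {E : Type*} [NormedAddCommGroup E] [InnerProductSpace ℝ E]

/-- Euler polygons with step `h` on an interval of length `n * h`. -/
theorem exists_euler_polygon (F : E → E) (x₀ : E) {h : ℝ} (hh : 0 < h) (n : ℕ) :
    ∃ p : ℝ → E, Continuous p ∧ p 0 = x₀ ∧ ∀ t ∈ Set.Ico 0 (n * h),
      ∃ s ∈ Set.Icc 0 t, t - s ≤ h ∧ HasDerivWithinAt p (F (p s)) (Set.Ici t) t := by
  induction n with
  | zero => exact ⟨fun _ => x₀, continuous_const, rfl, fun t ht => by simp at ht⟩
  | succ n ih =>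
    obtain ⟨p, hp, hp0, hpd⟩ := ih
    have hT : 0 ≤ n * h := by positivity
    set T : ℝ := n * h with hTdef
    -- The truncations glue `p` to a segment of velocity `F (p T)` without a case split, so
    -- continuity is automatic.
    set q : ℝ → E := fun t => p (min t T) + max 0 (t - T) • F (p T) with hq
    have hqle : ∀ t ≤ T, q t = p t := fun t ht => by
      simp [hq, min_eq_left ht, max_eq_left (sub_nonpos.2 ht)]
    refine ⟨q, by fun_prop, by rw [hqle 0 hT, hp0], fun t ht => ?_⟩
    rcases lt_or_ge t T with htT | htT
    · obtain ⟨s, hs, hst, hd⟩ := hpd t ⟨ht.1, htT⟩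
      refine ⟨s, hs, hst, ?_⟩
      rw [hqle s (hs.2.trans htT.le)]
      refine hd.congr_of_eventuallyEq ?_ (hqle t htT.le)
      exact mem_nhdsWithin_of_mem_nhds (mem_of_superset (Iio_mem_nhds htT)
        fun u hu => hqle u (le_of_lt hu))
    · refine ⟨T, ⟨hT, htT⟩, ?_, ?_⟩
      · have := ht.2
        push_cast at this
        linarith
      · rw [hqle T le_rfl]
        have hge : ∀ u ∈ Set.Ici t, q u = p T + (u - T) • F (p T) := fun u hu => by
          have : T ≤ u := htT.trans hu
          simp [hq, min_eq_right this, max_eq_right (sub_nonneg.2 this)]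
        refine HasDerivWithinAt.congr ?_ hge (hge t Set.self_mem_Ici)
        simpa using ((((hasDerivAt_id t).sub_const T).smul_const (F (p T))).const_add
          (p T)).hasDerivWithinAt

theorem hasDerivWithinAt_norm_sq {x : ℝ → E} {v : E} {s : Set ℝ} {t : ℝ}
    (h : HasDerivWithinAt x v s t) :
    HasDerivWithinAt (fun t => ‖x t‖ ^ 2) (2 * inner ℝ v (x t)) s t := by
  have := h.norm_sq
  rwa [real_inner_comm] at this

theorem norm_sq_le_of_inner_deriv_right_le {x x' : ℝ → E} {a b C : ℝ}
    (hx : ContinuousOn x (Set.Icc a b))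
    (hx' : ∀ t ∈ Set.Ico a b, HasDerivWithinAt x (x' t) (Set.Ici t) t)
    (bound : ∀ t ∈ Set.Ico a b, inner ℝ (x' t) (x t) ≤ C) {t : ℝ} (ht : t ∈ Set.Icc a b) :
    ‖x t‖ ^ 2 ≤ ‖x a‖ ^ 2 + 2 * C * (t - a) :=
  le_add_mul_of_deriv_right_le (f' := fun t => 2 * inner ℝ (x' t) (x t)) (by fun_prop)
    (fun t ht => hasDerivWithinAt_norm_sq (hx' t ht))
    (fun t ht => by linarith [bound t ht]) ht

/-- Approximate solutions of a dissipative equation, confined to a ball. -/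
theorem exists_approximate_trajectory [ProperSpace E] {F : E → E} (hF : Continuous F) {xs : E}
    (hdis : ∀ x, inner ℝ (F x) (x - xs) ≤ 0) (x₀ : E) {T ε : ℝ} (hT : 0 < T) (hε : 0 < ε) :
    ∃ p p' : ℝ → E, Continuous p ∧ p 0 = x₀ ∧
      (∀ t ∈ Set.Icc 0 T, p t ∈ Metric.closedBall xs (‖x₀ - xs‖ + 1)) ∧
      ∀ t ∈ Set.Ico 0 T, HasDerivWithinAt p (p' t) (Set.Ici t) t ∧
        ∃ y ∈ Metric.closedBall xs (‖x₀ - xs‖ + 1), p' t = F y ∧ ‖p t - y‖ ≤ ε := by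
  set R : ℝ := ‖x₀ - xs‖ with hR
  have hR0 : 0 ≤ R := norm_nonneg _
  -- A cutoff equal to `1` on the ball of radius `R + 1` and `0` outside radius `R + 2`. The
  -- truncated field is bounded everywhere, so the polygon has a speed bound before it is known to
  -- stay in the ball.
  set c : E → ℝ := fun x => max 0 (min 1 (R + 2 - ‖x - xs‖)) with hc
  have hc0 : ∀ x, 0 ≤ c x := fun x => le_max_left _ _
  have hc1 : ∀ x, c x ≤ 1 := fun x => max_le zero_le_one (min_le_left _ _)
  have hcin : ∀ x ∈ Metric.closedBall xs (R + 1), c x = 1 := fun x hx => by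
    rw [mem_closedBall_iff_norm] at hx
    have : (1 : ℝ) ≤ R + 2 - ‖x - xs‖ := by linarith
    simp [hc, min_eq_left this]
  obtain ⟨M, hM⟩ := (isCompact_closedBall xs (R + 2)).exists_bound_of_continuousOn
    hF.continuousOn
  have hM0 : 0 ≤ M := (norm_nonneg _).trans (hM xs (by simp; linarith))
  set H : E → E := fun x => c x • F x with hH
  have hHM : ∀ x, ‖H x‖ ≤ M := fun x => by
    by_cases hx : x ∈ Metric.closedBall xs (R + 2)
    · rw [hH]
      simp only [norm_smul, Real.norm_eq_abs, abs_of_nonneg (hc0 x)]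
      nlinarith [hM x hx, hc0 x, hc1 x, norm_nonneg (F x)]
    · rw [mem_closedBall_iff_norm, not_le] at hx
      have : R + 2 - ‖x - xs‖ ≤ 0 := by linarith
      have : c x = 0 := max_eq_left ((min_le_right _ _).trans this)
      simpa [hH, this] using hM0
  have hHdis : ∀ x, inner ℝ (H x) (x - xs) ≤ 0 := fun x => by
    rw [hH]
    simp only [inner_smul_left]
    exact mul_nonpos_of_nonneg_of_nonpos (hc0 x) (hdis x)
  -- The first bound makes the lag error `M * h` at most `ε`; the second lets the squared distance
  -- to `xs` grow by at most `1` over `[0, T]`, and `R² + 1 ≤ (R + 1)²`.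
  obtain ⟨n, hn⟩ := exists_nat_gt (max (M * T / ε) (2 * (M * M) * T * T))
  have hn0 : (0 : ℝ) < n := lt_of_le_of_lt (le_max_of_le_left (by positivity)) hn
  have hn1 := (le_max_left _ _).trans_lt hn
  have hn2 := (le_max_right _ _).trans_lt hn
  rw [div_lt_iff₀ hε] at hn1
  set h : ℝ := T / n with hh
  have hh0 : 0 < h := by positivity
  have hnh : n * h = T := by rw [hh]; field_simp
  have hMh : M * h ≤ ε := by
    rw [hh, ← mul_div_assoc, div_le_iff₀ hn0]; linarith
  have hMh2 : 2 * (M * (M * h)) * T ≤ 1 := by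
    have : 2 * (M * (M * h)) * T = 2 * (M * M) * T * T / n := by rw [hh]; ring
    rw [this, div_le_one hn0]; exact hn2.le
  obtain ⟨p, hp, hp0, hpd⟩ := exists_euler_polygon H x₀ hh0 n
  rw [hnh] at hpd
  choose! s hs hsh hd using hpd
  have hlip : ∀ t ∈ Set.Ico 0 T, ‖p t - p (s t)‖ ≤ M * h := fun t ht => by
    have h0 := (hs t ht).1
    have := norm_image_sub_le_of_norm_deriv_right_le_segment (f := p) (a := s t) (b := t)
      hp.continuousOn (fun u hu => hd u ⟨h0.trans hu.1, hu.2.trans ht.2⟩)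
      (fun u _ => hHM _) t ⟨(hs t ht).2, le_rfl⟩
    exact this.trans (mul_le_mul_of_nonneg_left (hsh t ht) hM0)
  have hball : ∀ t ∈ Set.Icc 0 T, p t ∈ Metric.closedBall xs (R + 1) := fun t ht => by
    have key := norm_sq_le_of_inner_deriv_right_le (x := fun t => p t - xs)
      (C := M * (M * h)) (by fun_prop) (fun u hu => (hd u hu).sub_const xs)
      (fun u hu => ?_) ht
    · rw [mem_closedBall_iff_norm]
      refine abs_le_of_sq_le_sq' ?_ (by positivity) |>.2
      simp only [hp0, sub_zero, ← hR] at key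
      have : 2 * (M * (M * h)) * t ≤ 2 * (M * (M * h)) * T :=
        mul_le_mul_of_nonneg_left ht.2 (by positivity)
      nlinarith
    -- Dissipativity applies at the node `p (s u)` where the velocity is evaluated; the lag costs at
    -- most `M * (M * h)`.
    · have e : p u - xs = (p (s u) - xs) + (p u - p (s u)) := by abel
      rw [e, inner_add_right]
      have h1 := hHdis (p (s u))
      have h2 := (real_inner_le_norm (H (p (s u))) (p u - p (s u))).trans
        (mul_le_mul (hHM _) (hlip u hu) (norm_nonneg _) hM0)
      linarith
  refine ⟨p, fun t => H (p (s t)), hp, hp0, hball, fun t ht => ⟨hd t ht, p (s t), ?_, ?_, ?_⟩⟩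
  · exact hball _ ⟨(hs t ht).1, (hs t ht).2.trans ht.2.le⟩
  · simp [hH, hcin _ (hball _ ⟨(hs t ht).1, (hs t ht).2.trans ht.2.le⟩)]
  · exact (hlip t ht).trans hMh

/-- Global forward solutions of `x' = F x` for continuous `F` with `-F` monotone, when `F` has a
zero. -/
theorem exists_trajectory_of_monotone [ProperSpace E] {F : E → E} (hF : Continuous F)
    (hmono : ∀ x y, inner ℝ (F x - F y) (x - y) ≤ 0) {xs : E} (hxs : F xs = 0) (x₀ : E) :
    ∃ x : ℝ → E, x 0 = x₀ ∧
      ∀ t, 0 ≤ t → HasDerivWithinAt x (F (x t)) (Set.Ici 0) t := by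
  have hdis : ∀ x, inner ℝ (F x) (x - xs) ≤ 0 := fun x => by simpa [hxs] using hmono x xs
  set B := Metric.closedBall xs (‖x₀ - xs‖ + 1) with hB
  have hBc : IsCompact B := isCompact_closedBall _ _
  obtain ⟨M, hM⟩ := hBc.exists_bound_of_continuousOn hF.continuousOn
  have hM0 : 0 ≤ M := (norm_nonneg _).trans (hM xs (by simp [hB]; positivity))
  have hε : ∀ n : ℕ, (0 : ℝ) < 1 / ((n : ℝ) + 1) := fun n => by positivity
  have hT : ∀ n : ℕ, (0 : ℝ) < (n : ℝ) + 1 := fun n => by positivity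
  choose p p' hp hp0 hpB hpd using fun n : ℕ =>
    exists_approximate_trajectory hF hdis x₀ (hT n) (hε n)
  -- Monotonicity is used at the points `y`, `w` where the two velocities are evaluated. The
  -- remainder pairs a velocity difference of at most `2 * M` with a displacement of at most `2 / (n
  -- + 1)`.
  have hdist : ∀ (n k : ℕ), n ≤ k → ∀ t ∈ Set.Icc (0 : ℝ) n,
      ‖p n t - p k t‖ ^ 2 ≤ 8 * M * t * (1 / ((n : ℝ) + 1)) := fun n k hnk t ht => by
    have hnk' : (n : ℝ) ≤ k := by exact_mod_cast hnk
    have hεk : 1 / ((k : ℝ) + 1) ≤ 1 / ((n : ℝ) + 1) :=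
      one_div_le_one_div_of_le (hT n) (by linarith)
    have key := norm_sq_le_of_inner_deriv_right_le (x := fun t => p n t - p k t)
      (C := 4 * M * (1 / ((n : ℝ) + 1))) (a := 0) (b := n)
      (((hp n).sub (hp k)).continuousOn)
      (fun u hu => (hpd n u ⟨hu.1, by linarith [hu.2]⟩).1.sub
        (hpd k u ⟨hu.1, by linarith [hu.2]⟩).1)
      (fun u hu => ?_) ht
    · simp only [hp0, sub_self, norm_zero, sub_zero] at key
      linarith
    · obtain ⟨-, y, hy, hy', hyp⟩ := hpd n u ⟨hu.1, by linarith [hu.2]⟩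
      obtain ⟨-, w, hw, hw', hwp⟩ := hpd k u ⟨hu.1, by linarith [hu.2]⟩
      rw [hy', hw', show p n u - p k u = (y - w) + ((p n u - y) - (p k u - w)) by abel,
        inner_add_right]
      have h1 := hmono y w
      have h2 : ‖F y - F w‖ ≤ M + M := norm_sub_le_of_le (hM y hy) (hM w hw)
      have h3 : ‖(p n u - y) - (p k u - w)‖ ≤ 1 / ((n : ℝ) + 1) + 1 / ((n : ℝ) + 1) :=
        norm_sub_le_of_le hyp (hwp.trans hεk)
      have h4 := (real_inner_le_norm (F y - F w) ((p n u - y) - (p k u - w))).trans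
        (mul_le_mul h2 h3 (norm_nonneg _) (by positivity))
      linarith
  have hsqrt : ∀ C : ℝ, Tendsto (fun n : ℕ => √(C * (1 / ((n : ℝ) + 1)))) atTop (𝓝 0) := fun C => by
    have := (tendsto_one_div_add_atTop_nhds_zero_nat (𝕜 := ℝ)).const_mul C
    simpa using this.sqrt
  have hcauchy : ∀ t : ℝ, 0 ≤ t → ∃ y, Tendsto (fun n => p n t) atTop (𝓝 y) := fun t ht => by
    refine cauchySeq_tendsto_of_complete (Metric.cauchySeq_iff'.2 fun ε hε' => ?_)
    obtain ⟨n, hn, hnt⟩ := ((hsqrt (8 * M * t)).eventually_lt_const hε' |>.and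
      (eventually_ge_atTop ⌈t⌉₊)).exists
    refine ⟨n, fun k hk => ?_⟩
    rw [dist_comm, dist_eq_norm]
    exact (Real.le_sqrt_of_sq_le (hdist n k hk t ⟨ht, Nat.ceil_le.1 hnt⟩)).trans_lt hn
  choose! x hx using hcauchy
  have hdistx : ∀ (n : ℕ), ∀ t ∈ Set.Icc (0 : ℝ) n,
      ‖p n t - x t‖ ^ 2 ≤ 8 * M * t * (1 / ((n : ℝ) + 1)) := fun n t ht =>
    le_of_tendsto ((((hx t ht.1).const_sub (p n t)).norm).pow 2)
      (eventually_atTop.2 ⟨n, fun k hk => hdist n k hk t ht⟩)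
  have hunif : ∀ T : ℝ, ∀ δ > 0, ∀ᶠ n : ℕ in atTop, T ≤ n ∧
      ∀ t ∈ Set.Icc 0 T, ‖p n t - x t‖ < δ := fun T δ hδ => by
    filter_upwards [(hsqrt (8 * M * T)).eventually_lt_const hδ, eventually_ge_atTop ⌈T⌉₊]
      with n hn hnT
    have hnT' := Nat.ceil_le.1 hnT
    refine ⟨hnT', fun t ht => lt_of_le_of_lt (Real.le_sqrt_of_sq_le ?_) hn⟩
    refine (hdistx n t ⟨ht.1, ht.2.trans hnT'⟩).trans ?_
    have := ht.2
    gcongr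
  have hx0 : x 0 = x₀ := tendsto_nhds_unique (hx 0 le_rfl) (by simp [hp0])
  have hcont : ContinuousOn x (Set.Ici 0) := by
    intro t ht
    have : ContinuousOn x (Set.Icc 0 (t + 1)) := by
      refine TendstoUniformlyOn.continuousOn (F := p) (p := atTop) ?_
        (Frequently.of_forall fun n => (hp n).continuousOn)
      rw [Metric.tendstoUniformlyOn_iff]
      intro δ hδ
      filter_upwards [hunif (t + 1) δ hδ] with n hn u hu
      rw [dist_comm, dist_eq_norm]
      exact hn.2 u hu
    refine (this t ⟨ht, by linarith⟩).mono_of_mem_nhdsWithin ?_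
    rw [← Set.Ici_inter_Iic]
    exact inter_mem self_mem_nhdsWithin
      (mem_nhdsWithin_of_mem_nhds (Iic_mem_nhds (by linarith)))
  have hxB : ∀ t, 0 ≤ t → x t ∈ B := fun t ht =>
    hBc.isClosed.mem_of_tendsto (hx t ht) (by
      filter_upwards [eventually_ge_atTop ⌈t⌉₊] with n hn
      exact hpB n t ⟨ht, (Nat.ceil_le.1 hn).trans (by linarith)⟩)
  -- Freezing `x` at its initial value for negative times gives an integrand continuous on the whole
  -- line; the limit is then shown to solve the integral equation.
  have hFx : Continuous fun t => F (x (max 0 t)) :=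
    hF.comp (hcont.comp_continuous (by fun_prop) fun t => Set.mem_Ici.2 (le_max_left _ _))
  set G : ℝ → E := fun t => ∫ s in (0 : ℝ)..t, F (x (max 0 s)) with hG
  have hGd : ∀ t, HasDerivAt G (F (x (max 0 t))) t := fun t =>
    intervalIntegral.integral_hasDerivAt_right (hFx.intervalIntegrable _ _)
      (hFx.stronglyMeasurableAtFilter _ _) hFx.continuousAt
  have hint : ∀ t, 0 ≤ t → x t = x₀ + G t := fun t ht => by
    have hle : ∀ η > 0, ‖x t - (x₀ + G t)‖ ≤ η * t := fun η hη => by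
      obtain ⟨δ, hδ, hFδ⟩ := Metric.uniformContinuousOn_iff.1
        (hBc.uniformContinuousOn_of_continuous hF.continuousOn) η hη
      refine le_of_tendsto (((hx t ht).sub_const _).norm) ?_
      filter_upwards [hunif t (δ / 2) (by positivity),
        (tendsto_one_div_add_atTop_nhds_zero_nat (𝕜 := ℝ)).eventually_lt_const
          (show (0 : ℝ) < δ / 2 by positivity)] with n hn hnδ
      have := norm_image_sub_le_of_norm_deriv_right_le_segment (f := fun t => p n t - G t)
        (a := 0) (b := t) (C := η) (f' := fun u => p' n u - F (x (max 0 u)))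
        ((hp n).continuousOn.sub fun u _ => (hGd u).continuousAt.continuousWithinAt)
        (fun u hu => (hpd n u ⟨hu.1, by linarith [hu.2, hn.1]⟩).1.sub (hGd u).hasDerivWithinAt)
        (fun u hu => ?_) t ⟨ht, le_rfl⟩
      · simp only [hp0, hG, intervalIntegral.integral_same, sub_zero] at this ⊢
        rwa [show p n t - (x₀ + ∫ s in (0 : ℝ)..t, F (x (max 0 s))) =
          p n t - (∫ s in (0 : ℝ)..t, F (x (max 0 s))) - x₀ by abel]
      · obtain ⟨-, y, hy, hy', hyp⟩ := hpd n u ⟨hu.1, by linarith [hu.2, hn.1]⟩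
        rw [hy', max_eq_right hu.1, ← dist_eq_norm]
        refine (hFδ y hy _ (hxB u hu.1) ?_).le
        have h1 := hn.2 u ⟨hu.1, hu.2.le⟩
        rw [← dist_eq_norm] at h1 hyp
        rw [dist_comm] at hyp
        linarith [dist_triangle y (p n u) (x u)]
    have : ‖x t - (x₀ + G t)‖ ≤ 0 := by
      refine le_of_forall_pos_le_add fun δ hδ => ?_
      have h1 : 0 < t + 1 := by linarith
      refine (hle (δ / (t + 1)) (by positivity)).trans ?_
      rw [zero_add, div_mul_eq_mul_div, div_le_iff₀ h1]
      nlinarith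
    exact sub_eq_zero.1 (norm_le_zero_iff.1 this)
  refine ⟨x, hx0, fun t ht => ?_⟩
  have := ((hGd t).const_add x₀).hasDerivWithinAt (s := Set.Ici 0)
  rw [max_eq_right ht] at this
  exact this.congr (fun u hu => hint u hu) (hint t ht)

end ODE

/-! ### Gradient inequalities for convex functions. -/

section Convex

variable {E : Type*} [NormedAddCommGroup E] [InnerProductSpace ℝ E] [CompleteSpace E]
  {f : E → ℝ}

/-- Strong convexity bounds the secant slopes from `x` towards `y`; let the step tend to `0` from
the right. The case `ω = 0` serves plain convexity. -/
theorem StrongConvexOn.inner_gradient_le {ω : ℝ} (hf : StrongConvexOn Set.univ ω f)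
    (hd : Differentiable ℝ f) (x y : E) :
    inner ℝ (gradient f x) (y - x) + ω / 2 * ‖x - y‖ ^ 2 ≤ f y - f x := by
  have hder : HasDerivAt (fun t : ℝ => f (x + t • (y - x))) (inner ℝ (gradient f x) (y - x)) 0 := by
    have h1 : HasFDerivAt f (InnerProductSpace.toDual ℝ E (gradient f x)) (x + (0 : ℝ) • (y - x)) := by
      simpa using (hd x).hasGradientAt.hasFDerivAt
    have h2 : HasDerivAt (fun t : ℝ => x + t • (y - x)) (y - x) 0 := by
      simpa using ((hasDerivAt_id (0 : ℝ)).smul_const (y - x)).const_add x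
    exact h1.comp_hasDerivAt (0 : ℝ) h2
  have hlim := (hasDerivAt_iff_tendsto_slope_zero.1 hder).mono_left
    (nhdsWithin_mono 0 (fun t (ht : 0 < t) => ht.ne') : 𝓝[>] (0 : ℝ) ≤ _)
  have hlim2 : Tendsto (fun t : ℝ => f y - f x - (1 - t) * (ω / 2 * ‖x - y‖ ^ 2)) (𝓝[>] 0)
      (𝓝 (f y - f x - (1 - 0) * (ω / 2 * ‖x - y‖ ^ 2))) := by
    refine Continuous.continuousWithinAt ?_
    fun_prop
  have := le_of_tendsto_of_tendsto hlim hlim2 ?_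
  · linarith
  · filter_upwards [Ioo_mem_nhdsGT (zero_lt_one (α := ℝ))] with t ht
    have := hf.2 (Set.mem_univ x) (Set.mem_univ y) (sub_nonneg.2 ht.2.le) ht.1.le (by ring)
    rw [show (1 - t) • x + t • y = x + t • (y - x) by module] at this
    simp only [zero_add, zero_smul, add_zero, smul_eq_mul] at this ⊢
    rw [inv_mul_le_iff₀ ht.1]
    linarith

theorem StrongConvexOn.mul_norm_sq_le_inner_gradient {ω : ℝ} (hf : StrongConvexOn Set.univ ω f)
    (hd : Differentiable ℝ f) (x y : E) :
    ω * ‖x - y‖ ^ 2 ≤ inner ℝ (gradient f x - gradient f y) (x - y) := by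
  have h1 := hf.inner_gradient_le hd x y
  have h2 := hf.inner_gradient_le hd y x
  rw [norm_sub_rev y x] at h2
  rw [← neg_sub x y, inner_neg_right] at h1
  rw [inner_sub_left]
  linarith

theorem ConvexOn.inner_gradient_le (hf : ConvexOn ℝ Set.univ f)
    (hd : Differentiable ℝ f) (x y : E) :
    inner ℝ (gradient f x) (y - x) ≤ f y - f x := by
  simpa using (strongConvexOn_zero.2 hf).inner_gradient_le hd x y

theorem ConvexOn.inner_gradient_nonneg (hf : ConvexOn ℝ Set.univ f)
    (hd : Differentiable ℝ f) (x y : E) :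
    0 ≤ inner ℝ (gradient f x - gradient f y) (x - y) := by
  simpa using (strongConvexOn_zero.2 hf).mul_norm_sq_le_inner_gradient hd x y

/-- Strictness is lost in a limit of slopes, so it is taken at the midpoint and combined with the
non-strict inequality there. -/
theorem StrictConvexOn.inner_gradient_lt (hf : StrictConvexOn ℝ Set.univ f)
    (hd : Differentiable ℝ f) {x y : E} (hxy : x ≠ y) :
    inner ℝ (gradient f x) (y - x) < f y - f x := by
  have h1 := hf.2 (Set.mem_univ x) (Set.mem_univ y) hxy (one_half_pos (α := ℝ))
    (one_half_pos (α := ℝ)) (by norm_num)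
  have h2 := hf.convexOn.inner_gradient_le hd x ((1 / 2 : ℝ) • x + (1 / 2 : ℝ) • y)
  rw [show (1 / 2 : ℝ) • x + (1 / 2 : ℝ) • y - x = (1 / 2 : ℝ) • (y - x) by module,
    inner_smul_right] at h2
  simp only [smul_eq_mul] at h1
  linarith

theorem StrictConvexOn.inner_gradient_pos (hf : StrictConvexOn ℝ Set.univ f)
    (hd : Differentiable ℝ f) {x y : E} (hxy : x ≠ y) :
    0 < inner ℝ (gradient f x - gradient f y) (x - y) := by
  have h1 := hf.inner_gradient_lt hd hxy
  have h2 := hf.inner_gradient_lt hd hxy.symm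
  rw [← neg_sub x y, inner_neg_right] at h1
  rw [inner_sub_left]
  linarith

/-- The gradient of a differentiable convex function is continuous. -/
theorem ConvexOn.continuous_gradient (hf : ConvexOn ℝ Set.univ f) (hd : Differentiable ℝ f) :
    Continuous (gradient f) := by
  rw [continuous_iff_continuousAt]
  intro x
  rw [Metric.continuousAt_iff]
  intro ε hε
  have hx := (hd x).hasGradientAt.hasFDerivAt.isLittleO.bound (show 0 < ε / 3 by positivity)
  obtain ⟨δ, hδ, hball⟩ := Metric.eventually_nhds_iff.1 hx
  refine ⟨δ / 2, by positivity, fun y hy => ?_⟩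
  rw [dist_eq_norm] at hy ⊢
  set v := gradient f y - gradient f x with hv
  rcases eq_or_ne v 0 with h0 | h0
  · simpa [h0] using hε
  have hvp : 0 < ‖v‖ := norm_pos_iff.2 h0
  -- The point `y + w` stays within `δ` of `x`, as `δ / 2 + δ / 3 < δ`, so the first-order expansion
  -- at `x` applies. Testing the gradient inequality at `y` in direction `v` then bounds `‖v‖`.
  set w := (δ / 3 / ‖v‖) • v with hw
  have hwn : ‖w‖ = δ / 3 := by
    rw [hw, norm_smul, Real.norm_of_nonneg (by positivity)]
    field_simp
  have hn : ‖y + w - x‖ ≤ ‖y - x‖ + δ / 3 := by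
    rw [show y + w - x = (y - x) + w by abel, ← hwn]
    exact norm_add_le _ _
  have h1 := hball (show dist (y + w) x < δ by rw [dist_eq_norm]; linarith)
  have h2 := hf.inner_gradient_le hd y (y + w)
  have h3 := hf.inner_gradient_le hd x y
  rw [InnerProductSpace.toDual_apply_apply, Real.norm_eq_abs] at h1
  have h4 := (le_abs_self _).trans h1
  rw [show y + w - y = w by abel] at h2
  rw [show y + w - x = (y - x) + w by abel, inner_add_right] at h4
  rw [show (y - x) + w = y + w - x by abel] at h4
  have h5 : inner ℝ v w = δ / 3 * ‖v‖ := by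
    rw [hw, inner_smul_right, real_inner_self_eq_norm_sq]
    field_simp
  have h6 : inner ℝ v w = inner ℝ (gradient f y) w - inner ℝ (gradient f x) w := inner_sub_left _ _ _
  have h7 : δ / 3 * ‖v‖ ≤ ε / 3 * (‖y - x‖ + δ / 3) := by
    have := mul_le_mul_of_nonneg_left hn (show 0 ≤ ε / 3 by positivity)
    linarith
  have h8 : ε / 3 * (‖y - x‖ + δ / 3) < ε / 3 * δ :=
    mul_lt_mul_of_pos_left (by linarith) (by positivity)
  have : δ * ‖v‖ < δ * ε := by linarith
  exact lt_of_mul_lt_mul_left this hδ.le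

end Convex

/-! ### Lyapunov arguments with one-sided derivatives. -/

section Lyapunov

theorem antitoneOn_of_deriv_right_nonpos {V V' : ℝ → ℝ}
    (hV : ∀ t, 0 ≤ t → HasDerivWithinAt V (V' t) (Set.Ici 0) t)
    (hV' : ∀ t, 0 ≤ t → V' t ≤ 0) : AntitoneOn V (Set.Ici 0) := fun a ha b _ hab => by
  have := le_add_mul_of_deriv_right_le (f := V) (f' := V') (C := 0)
    (fun t ht => ((hV t (le_trans ha ht.1)).continuousWithinAt).mono
      fun u hu => le_trans ha hu.1)
    (fun t ht => (hV t (le_trans ha ht.1)).mono (Set.Ici_subset_Ici.2 (le_trans ha ht.1)))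
    (fun t ht => hV' t (le_trans ha ht.1)) (Set.right_mem_Icc.2 hab)
  simpa using this

theorem le_mul_exp_of_deriv_right_le {V V' : ℝ → ℝ} {c : ℝ}
    (hV : ∀ t, 0 ≤ t → HasDerivWithinAt V (V' t) (Set.Ici 0) t)
    (hV' : ∀ t, 0 ≤ t → V' t ≤ -c * V t) {t : ℝ} (ht : 0 ≤ t) :
    V t ≤ V 0 * Real.exp (-c * t) := by
  have hd : ∀ t, 0 ≤ t → HasDerivWithinAt (fun t => V t * Real.exp (c * t))
      ((V' t + c * V t) * Real.exp (c * t)) (Set.Ici 0) t := fun t ht => by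
    have h1 : HasDerivAt (fun t => Real.exp (c * t)) (Real.exp (c * t) * c) t := by
      simpa using ((hasDerivAt_id t).const_mul c).exp
    exact ((hV t ht).mul h1.hasDerivWithinAt).congr_deriv (by ring)
  have := antitoneOn_of_deriv_right_nonpos hd (fun t ht =>
    mul_nonpos_of_nonpos_of_nonneg (by linarith [hV' t ht]) (Real.exp_pos _).le)
    (Set.mem_Ici.2 le_rfl) (Set.mem_Ici.2 ht) ht
  simp only [mul_zero, Real.exp_zero, mul_one] at this
  calc V t = V t * Real.exp (c * t) * Real.exp (-c * t) := by
        rw [mul_assoc, ← Real.exp_add]; simp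
    _ ≤ _ := mul_le_mul_of_nonneg_right this (Real.exp_pos _).le

/-- A Lyapunov function whose decay rate `w` vanishes only at `xs` forces a bounded trajectory with
bounded velocity to converge to `xs`. -/
theorem tendsto_of_lyapunov {X : Type*} [NormedAddCommGroup X] [NormedSpace ℝ X] [ProperSpace X]
    {V : ℝ → ℝ} {z z' : ℝ → X} {w : X → ℝ} {xs : X} {R M : ℝ}
    (hV : ∀ t, 0 ≤ t → HasDerivWithinAt V (-w (z t)) (Set.Ici 0) t)
    (hV0 : ∀ t, 0 ≤ t → 0 ≤ V t)
    (hw : Continuous w) (hw0 : ∀ x, 0 ≤ w x) (hwpos : ∀ x, x ≠ xs → 0 < w x)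
    (hz : ∀ t, 0 ≤ t → HasDerivWithinAt z (z' t) (Set.Ici 0) t)
    (hz' : ∀ t, 0 ≤ t → ‖z' t‖ ≤ M) (hR : ∀ t, 0 ≤ t → ‖z t - xs‖ ≤ R) :
    Tendsto z atTop (𝓝 xs) := by
  have hM0 : 0 ≤ M := (norm_nonneg _).trans (hz' 0 le_rfl)
  have hanti := antitoneOn_of_deriv_right_nonpos hV fun t _ => neg_nonpos.2 (hw0 _)
  obtain ⟨ℓ, hℓ⟩ : ∃ ℓ, Tendsto (fun t => V (max 0 t)) atTop (𝓝 ℓ) := by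
    refine ⟨_, tendsto_atTop_ciInf (fun a b hab => ?_) ⟨0, ?_⟩⟩
    · exact hanti (Set.mem_Ici.2 (le_max_left _ _)) (Set.mem_Ici.2 (le_max_left _ _))
        (max_le_max le_rfl hab)
    · rintro _ ⟨t, rfl⟩
      exact hV0 _ (le_max_left _ _)
  rw [Metric.tendsto_atTop']
  intro ε hε
  -- Compactness of the shell gives a uniform decay rate away from `xs`.
  obtain ⟨c, hc, hcw⟩ : ∃ c > 0, ∀ x, ε / 2 ≤ ‖x - xs‖ → ‖x - xs‖ ≤ R → c ≤ w x := by
    have hK : IsCompact (Metric.closedBall xs R ∩ {x | ε / 2 ≤ ‖x - xs‖}) :=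
      (isCompact_closedBall _ _).inter_right (isClosed_le (by fun_prop) (by fun_prop))
    rcases (Metric.closedBall xs R ∩ {x | ε / 2 ≤ ‖x - xs‖}).eq_empty_or_nonempty with h | h
    · refine ⟨1, one_pos, fun x h1 h2 => ?_⟩
      have : x ∈ Metric.closedBall xs R ∩ {x | ε / 2 ≤ ‖x - xs‖} :=
        ⟨mem_closedBall_iff_norm.2 h2, h1⟩
      simp [h] at this
    · obtain ⟨x₀, hx₀, hmin⟩ := hK.exists_isMinOn h hw.continuousOn
      refine ⟨w x₀, hwpos x₀ ?_, fun x h1 h2 => hmin ⟨mem_closedBall_iff_norm.2 h2, h1⟩⟩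
      rintro rfl
      have := hx₀.2
      simp only [Set.mem_ofPred_eq, sub_self, norm_zero] at this
      linarith
  -- In time `δ` the trajectory moves at most `ε / 2`. A late excursion beyond `ε` would therefore
  -- cost `V` at least `c * δ`, contradicting its convergence.
  set δ := ε / (2 * (M + 1)) with hδ
  have hδ0 : 0 < δ := by positivity
  have hMδ : M * δ ≤ ε / 2 := by
    rw [hδ, ← mul_div_assoc, div_le_div_iff₀ (by positivity) (by positivity)]
    nlinarith
  have hdiff : Tendsto (fun t => V (max 0 t) - V (max 0 (t + δ))) atTop (𝓝 (ℓ - ℓ)) :=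
    hℓ.sub (hℓ.comp (tendsto_atTop_add_const_right _ _ tendsto_id))
  rw [sub_self] at hdiff
  obtain ⟨T, hT⟩ := eventually_atTop.1 (hdiff.eventually_lt_const
    (show 0 < c * δ by positivity))
  refine ⟨max T 0, fun t ht => ?_⟩
  have ht0 : 0 ≤ t := (le_max_right _ _).trans ht.le
  by_contra! hfar
  rw [dist_eq_norm] at hfar
  have hstay : ∀ u ∈ Set.Ico t (t + δ), ε / 2 ≤ ‖z u - xs‖ := fun u hu => by
    have := norm_image_sub_le_of_norm_deriv_right_le_segment (f := z) (f' := z') (a := t) (b := u)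
      (fun s hs => ((hz s (ht0.trans hs.1)).continuousWithinAt).mono
        fun v hv => ht0.trans hv.1)
      (fun s hs => (hz s (ht0.trans hs.1)).mono (Set.Ici_subset_Ici.2 (ht0.trans hs.1)))
      (fun s hs => hz' s (ht0.trans hs.1)) u ⟨hu.1, le_rfl⟩
    have h1 : M * (u - t) ≤ M * δ := mul_le_mul_of_nonneg_left (by linarith [hu.2]) hM0
    have h2 : ‖z t - xs‖ ≤ ‖z u - xs‖ + ‖z u - z t‖ := by
      rw [show z t - xs = (z u - xs) - (z u - z t) by abel]
      exact norm_sub_le _ _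
    linarith
  have hdec := le_add_mul_of_deriv_right_le (f := V) (f' := fun u => -w (z u)) (C := -c)
    (a := t) (b := t + δ)
    (fun s hs => ((hV s (ht0.trans hs.1)).continuousWithinAt).mono fun v hv => ht0.trans hv.1)
    (fun s hs => (hV s (ht0.trans hs.1)).mono (Set.Ici_subset_Ici.2 (ht0.trans hs.1)))
    (fun s hs => neg_le_neg (hcw _ (hstay s hs) (hR s (ht0.trans hs.1))))
    (Set.right_mem_Icc.2 (by linarith))
  have := hT t ((le_max_left _ _).trans ht.le)
  rw [max_eq_right ht0, max_eq_right (by linarith)] at this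
  linarith

end Lyapunov

/-! ### The abstract saddle flow: energy, existence, convergence, exponential rate. -/

section SaddleFlow

theorem hasDerivWithinAt_saddle_energy {X : Type*} [NormedAddCommGroup X]
    [InnerProductSpace ℝ X] {g : X → X} {L : X →L[ℝ] X} {zs ls : X} {z l : ℝ → X}
    (hL : ∀ x y, inner ℝ (L x) y = inner ℝ x (L y))
    (hz : L zs = 0) (hl : g zs + L ls = 0)
    (hzd : ∀ t, 0 ≤ t → HasDerivWithinAt z (-g (z t) - L (l t)) (Set.Ici 0) t)
    (hld : ∀ t, 0 ≤ t → HasDerivWithinAt l (L (z t)) (Set.Ici 0) t) {t : ℝ} (ht : 0 ≤ t) :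
    HasDerivWithinAt (fun t => ‖z t - zs‖ ^ 2 + ‖l t - ls‖ ^ 2)
      (-(2 * inner ℝ (g (z t) - g zs) (z t - zs))) (Set.Ici 0) t := by
  have h1 := hasDerivWithinAt_norm_sq ((hzd t ht).sub_const zs)
  have h2 := hasDerivWithinAt_norm_sq ((hld t ht).sub_const ls)
  refine (h1.add h2).congr_deriv ?_
  have e1 : -g (z t) - L (l t) = -(g (z t) - g zs) - L (l t - ls) := by
    rw [map_sub, ← add_zero (-g (z t)), ← hl]; abel
  have e2 : L (z t) = L (z t - zs) := by rw [map_sub, hz, sub_zero]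
  rw [e1, e2, hL (z t - zs), inner_sub_left, inner_neg_left, real_inner_comm (z t - zs) (L _)]
  ring

variable {X : Type*} [NormedAddCommGroup X] [InnerProductSpace ℝ X] [FiniteDimensional ℝ X]
  {g : X → X} {L : X →L[ℝ] X} {zs ls : X}

/-- On the Hilbert product the skew coupling drops out of the monotonicity pairing, so the field
inherits dissipativity from `g`. -/
theorem exists_saddle_trajectory (hg : Continuous g)
    (hmono : ∀ x y, 0 ≤ inner ℝ (g x - g y) (x - y))
    (hL : ∀ x y, inner ℝ (L x) y = inner ℝ x (L y))
    (hz : L zs = 0) (hl : g zs + L ls = 0) (z₀ l₀ : X) :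
    ∃ z l : ℝ → X, z 0 = z₀ ∧ l 0 = l₀ ∧
      (∀ t, 0 ≤ t → HasDerivWithinAt z (-g (z t) - L (l t)) (Set.Ici 0) t) ∧
      (∀ t, 0 ≤ t → HasDerivWithinAt l (L (z t)) (Set.Ici 0) t) := by
  set F : WithLp 2 (X × X) → WithLp 2 (X × X) :=
    fun p => WithLp.toLp 2 (-g p.fst - L p.snd, L p.fst) with hF
  have hFc : Continuous F := by
    have h1 : Continuous fun p : WithLp 2 (X × X) => p.fst :=
      continuous_fst.comp (WithLp.prod_continuous_ofLp 2 X X)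
    have h2 : Continuous fun p : WithLp 2 (X × X) => p.snd :=
      continuous_snd.comp (WithLp.prod_continuous_ofLp 2 X X)
    exact (WithLp.prod_continuous_toLp 2 X X).comp (by fun_prop)
  obtain ⟨x, hx0, hx⟩ := exists_trajectory_of_monotone hFc (xs := WithLp.toLp 2 (zs, ls))
    (fun p q => by
      rw [WithLp.prod_inner_apply]
      change inner ℝ (-g p.fst - L p.snd - (-g q.fst - L q.snd)) (p.fst - q.fst) +
        inner ℝ (L p.fst - L q.fst) (p.snd - q.snd) ≤ 0
      rw [show -g p.fst - L p.snd - (-g q.fst - L q.snd) =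
          -(g p.fst - g q.fst) - L (p.snd - q.snd) by rw [map_sub]; abel,
        ← map_sub, hL (p.fst - q.fst), inner_sub_left, inner_neg_left,
        real_inner_comm (p.fst - q.fst) (L _)]
      linarith [hmono p.fst q.fst])
    (by
      have : -g zs - L ls = 0 := by rw [← neg_add', hl, neg_zero]
      simp [hF, hz, this])
    (WithLp.toLp 2 (z₀, l₀))
  refine ⟨fun t => (x t).fst, fun t => (x t).snd, by simp [hx0], by simp [hx0],
    fun t ht => ?_, fun t ht => ?_⟩
  · exact ((WithLp.fstL 2 ℝ X X).hasFDerivAt.comp_hasDerivWithinAt t (hx t ht))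
  · exact ((WithLp.sndL 2 ℝ X X).hasFDerivAt.comp_hasDerivWithinAt t (hx t ht))

variable {z l : ℝ → X}

theorem saddle_trajectory_bounded_and_tendsto (hg : Continuous g)
    (hmono : ∀ x y, x ≠ y → 0 < inner ℝ (g x - g y) (x - y))
    (hL : ∀ x y, inner ℝ (L x) y = inner ℝ x (L y))
    (hz : L zs = 0) (hl : g zs + L ls = 0)
    (hzd : ∀ t, 0 ≤ t → HasDerivWithinAt z (-g (z t) - L (l t)) (Set.Ici 0) t)
    (hld : ∀ t, 0 ≤ t → HasDerivWithinAt l (L (z t)) (Set.Ici 0) t) :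
    (∃ C, ∀ t, 0 ≤ t → ‖z t‖ ≤ C ∧ ‖l t‖ ≤ C) ∧ Tendsto z atTop (𝓝 zs) := by
  have : ProperSpace X := FiniteDimensional.proper ℝ X
  have hd := fun t ht => hasDerivWithinAt_saddle_energy hL hz hl hzd hld (t := t) ht
  have hw0 : ∀ x, 0 ≤ 2 * inner ℝ (g x - g zs) (x - zs) := fun x => by
    rcases eq_or_ne x zs with rfl | h
    · simp
    · exact mul_nonneg zero_le_two (hmono x zs h).le
  set V : ℝ → ℝ := fun t => ‖z t - zs‖ ^ 2 + ‖l t - ls‖ ^ 2 with hV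
  have hanti := antitoneOn_of_deriv_right_nonpos hd fun t _ => neg_nonpos.2 (hw0 (z t))
  have hle : ∀ t, 0 ≤ t → V t ≤ V 0 := fun t ht =>
    hanti (Set.mem_Ici.2 le_rfl) (Set.mem_Ici.2 ht) ht
  have hzR : ∀ t, 0 ≤ t → ‖z t - zs‖ ≤ √(V 0) := fun t ht =>
    Real.le_sqrt_of_sq_le (by
      have := hle t ht
      simp only [hV] at this ⊢
      nlinarith [sq_nonneg ‖l t - ls‖])
  have hlR : ∀ t, 0 ≤ t → ‖l t - ls‖ ≤ √(V 0) := fun t ht =>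
    Real.le_sqrt_of_sq_le (by
      have := hle t ht
      simp only [hV] at this ⊢
      nlinarith [sq_nonneg ‖z t - zs‖])
  obtain ⟨M, hM⟩ := (isCompact_closedBall zs √(V 0)).exists_bound_of_continuousOn hg.continuousOn
  refine ⟨⟨√(V 0) + ‖zs‖ + ‖ls‖, fun t ht => ⟨?_, ?_⟩⟩, ?_⟩
  · linarith [norm_le_norm_sub_add (z t) zs, hzR t ht, norm_nonneg ls]
  · linarith [norm_le_norm_sub_add (l t) ls, hlR t ht, norm_nonneg zs]
  · refine tendsto_of_lyapunov (w := fun x => 2 * inner ℝ (g x - g zs) (x - zs)) (R := √(V 0))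
      (M := M + ‖L‖ * (√(V 0) + ‖ls‖)) hd (fun t _ => by positivity) (by fun_prop) hw0
      (fun x hx => mul_pos two_pos (hmono x zs hx)) hzd (fun t ht => ?_) hzR
    refine norm_sub_le_of_le ?_ ?_
    · rw [norm_neg]
      exact hM _ (mem_closedBall_iff_norm.2 (hzR t ht))
    · refine (L.le_opNorm _).trans (mul_le_mul_of_nonneg_left ?_ (norm_nonneg _))
      linarith [norm_le_norm_sub_add (l t) ls, hlR t ht]

/-- The energy derivative does not see `l`. The cross term `ε * ⟪e, L μ⟫` supplies `-ε * ‖L μ‖²`.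
The part of `l - ls` orthogonal to the range of `L` neither moves nor influences `z`, so `μ`
projects it away. -/
theorem saddle_trajectory_exp_decay
    (hL : ∀ x y, inner ℝ (L x) y = inner ℝ x (L y))
    (hz : L zs = 0) (hl : g zs + L ls = 0) {ω ϑ : ℝ} (hω : 0 < ω)
    (hstrong : ∀ x y, ω * ‖x - y‖ ^ 2 ≤ inner ℝ (g x - g y) (x - y))
    (hlip : ∀ x y, ‖g x - g y‖ ≤ ϑ * ‖x - y‖) :
    ∃ γ : ℝ, 0 < γ ∧ ∀ z l : ℝ → X,
      (∀ t, 0 ≤ t → HasDerivWithinAt z (-g (z t) - L (l t)) (Set.Ici 0) t) →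
      (∀ t, 0 ≤ t → HasDerivWithinAt l (L (z t)) (Set.Ici 0) t) →
      ∃ C : ℝ, ∀ t, 0 ≤ t → ‖z t - zs‖ ≤ C * Real.exp (-γ * t) := by
  set K := L.toLinearMap.range with hK
  set P : X →L[ℝ] X := K.starProjection with hP
  have hPL : ∀ x, P (L x) = L x := fun x =>
    Submodule.starProjection_eq_self_iff.2 ⟨x, rfl⟩
  have hLP : ∀ x, L (P x) = L x := fun x => by
    have h1 : x - P x ∈ Kᗮ := K.sub_starProjection_mem_orthogonal x
    rw [← sub_eq_zero, ← map_sub, ← inner_self_eq_zero (𝕜 := ℝ), hL, ← neg_sub x, map_neg,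
      map_neg, inner_neg_left, inner_neg_right, neg_neg]
    rw [real_inner_comm]
    exact (Submodule.mem_orthogonal _ _).1 h1 _ ⟨L (x - P x), rfl⟩
  -- A symmetric `L` is injective on its range, hence bounded below there in finite dimension.
  obtain ⟨σ, hσ, hσK⟩ : ∃ σ > 0, ∀ x, σ * ‖P x‖ ^ 2 ≤ ‖L x‖ ^ 2 := by
    have hker : (L.toLinearMap.domRestrict K).ker = ⊥ := by
      rw [LinearMap.ker_eq_bot']
      rintro ⟨_, x, rfl⟩ hx
      have hx' : L (L x) = 0 := hx
      have : inner ℝ (L x) (L x) = (0 : ℝ) := by rw [hL, hx', inner_zero_right]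
      ext
      exact inner_self_eq_zero.1 this
    obtain ⟨k, hk, hanti⟩ := LinearMap.exists_antilipschitzWith _ hker
    refine ⟨((k : ℝ) ^ 2)⁻¹, by positivity, fun x => ?_⟩
    have := hanti.le_mul_dist ⟨P x, K.starProjection_apply_mem x⟩ 0
    simp only [map_zero, dist_zero_right] at this
    have h2 : ‖P x‖ ≤ k * ‖L x‖ := by rw [← hLP x]; exact this
    rw [inv_mul_le_iff₀ (by positivity), ← mul_pow]
    gcongr
  set Λ := ‖L‖ with hΛ
  have hΛ0 : 0 ≤ Λ := norm_nonneg _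
  have hLn : ∀ x, ‖L x‖ ≤ Λ * ‖x‖ := L.le_opNorm
  -- the weight of the cross term
  obtain ⟨ε, hε, hε1, hε2⟩ : ∃ ε > 0, ε * (ϑ ^ 2 / 2 + Λ ^ 2) ≤ ω / 2 ∧ ε * Λ ≤ 1 / 2 := by
    refine ⟨min (ω / 2 / (ϑ ^ 2 / 2 + Λ ^ 2 + 1)) (1 / 2 / (Λ + 1)), by positivity, ?_, ?_⟩
    · refine (mul_le_mul_of_nonneg_right (min_le_left _ _) (by positivity)).trans ?_
      rw [div_mul_eq_mul_div, div_le_iff₀ (by positivity)]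
      nlinarith
    · refine (mul_le_mul_of_nonneg_right (min_le_right _ _) (by positivity)).trans ?_
      rw [div_mul_eq_mul_div, div_le_iff₀ (by positivity)]
      nlinarith
  -- These are the decay coefficients left for `‖e‖²` and `‖μ‖²` after absorbing the cross terms.
  -- The final rate is `c / 2` because `W` controls the square of `‖e‖`.
  set c := min (ω / 2) (ε * σ / 2) with hc
  have hc0 : 0 < c := by positivity
  refine ⟨c / 2, by positivity, fun z l hzd hld => ?_⟩
  set e : ℝ → X := fun t => z t - zs with he
  set μ : ℝ → X := fun t => P (l t - ls) with hμ
  set W : ℝ → ℝ := fun t => (‖e t‖ ^ 2 + ‖μ t‖ ^ 2) / 2 + ε * inner ℝ (e t) (L (μ t)) with hW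
  have hed : ∀ t, 0 ≤ t →
      HasDerivWithinAt e (-(g (z t) - g zs) - L (μ t)) (Set.Ici 0) t := fun t ht => by
    refine ((hzd t ht).sub_const zs).congr_deriv ?_
    simp only [hμ]
    rw [hLP, map_sub, ← add_zero (-g (z t)), ← hl]; abel
  have hμd : ∀ t, 0 ≤ t → HasDerivWithinAt μ (L (e t)) (Set.Ici 0) t := fun t ht => by
    refine (P.hasFDerivAt.comp_hasDerivWithinAt t ((hld t ht).sub_const ls)).congr_deriv ?_
    simp only [he]
    rw [hPL, map_sub, hz, sub_zero]
  have hcross : ∀ t, |inner ℝ (e t) (L (μ t))| ≤ Λ * ((‖e t‖ ^ 2 + ‖μ t‖ ^ 2) / 2) := fun t => by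
    refine (abs_real_inner_le_norm _ _).trans ?_
    have h1 := mul_le_mul_of_nonneg_left (hLn (μ t)) (norm_nonneg (e t))
    have h2 := mul_nonneg hΛ0 (sq_nonneg (‖e t‖ - ‖μ t‖))
    linarith
  have hWbd : ∀ t, (‖e t‖ ^ 2 + ‖μ t‖ ^ 2) / 4 ≤ W t ∧ W t ≤ ‖e t‖ ^ 2 + ‖μ t‖ ^ 2 := fun t => by
    have h1 := abs_le.1 (hcross t)
    have h0 : 0 ≤ ‖e t‖ ^ 2 + ‖μ t‖ ^ 2 := by positivity
    have h2 := mul_le_mul_of_nonneg_left h1.1 hε.le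
    have h3 := mul_le_mul_of_nonneg_left h1.2 hε.le
    have h4 := mul_le_mul_of_nonneg_right hε2 h0
    simp only [hW]
    constructor <;> linarith
  have hWd : ∀ t, 0 ≤ t → HasDerivWithinAt W
      (-inner ℝ (g (z t) - g zs) (e t) + ε * (‖L (e t)‖ ^ 2 - ‖L (μ t)‖ ^ 2 -
        inner ℝ (g (z t) - g zs) (L (μ t)))) (Set.Ici 0) t := fun t ht => by
    have h1 := hasDerivWithinAt_norm_sq (hed t ht)
    have h2 := hasDerivWithinAt_norm_sq (hμd t ht)
    have h3 := (hed t ht).inner ℝ (L.hasFDerivAt.comp_hasDerivWithinAt t (hμd t ht))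
    refine (((h1.add h2).div_const 2).add (h3.const_mul ε)).congr_deriv ?_
    simp only [Function.comp_apply]
    rw [hL (e t) (μ t), ← hL (e t) (L (e t)), real_inner_self_eq_norm_sq,
      inner_sub_left (-(g (z t) - g zs)) (L (μ t)) (e t),
      inner_sub_left (-(g (z t) - g zs)) (L (μ t)) (L (μ t)), inner_neg_left, inner_neg_left,
      real_inner_self_eq_norm_sq, real_inner_comm (e t) (L (μ t))]
    ring
  have hWle : ∀ t, 0 ≤ t → -inner ℝ (g (z t) - g zs) (e t) + ε * (‖L (e t)‖ ^ 2 - ‖L (μ t)‖ ^ 2 -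
        inner ℝ (g (z t) - g zs) (L (μ t))) ≤ -c * W t := fun t _ => by
    have h1 := hstrong (z t) zs
    have h2 : -inner ℝ (g (z t) - g zs) (L (μ t)) ≤
        (ϑ * ‖e t‖) ^ 2 / 2 + ‖L (μ t)‖ ^ 2 / 2 := by
      have a1 := neg_le_of_abs_le (abs_real_inner_le_norm (g (z t) - g zs) (L (μ t)))
      have a2 := mul_le_mul_of_nonneg_right (hlip (z t) zs) (norm_nonneg (L (μ t)))
      have a3 := sq_nonneg (ϑ * ‖z t - zs‖ - ‖L (μ t)‖)
      simp only [he]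
      linarith
    have h3 : ‖L (e t)‖ ^ 2 ≤ Λ ^ 2 * ‖e t‖ ^ 2 := by
      rw [← mul_pow]; have := hLn (e t); gcongr
    have h4 : σ * ‖μ t‖ ^ 2 ≤ ‖L (μ t)‖ ^ 2 := by
      simp only [hμ]; rw [hLP]; exact hσK _
    have h5 : ε * (‖L (e t)‖ ^ 2 - ‖L (μ t)‖ ^ 2 - inner ℝ (g (z t) - g zs) (L (μ t))) ≤
        ε * ((ϑ ^ 2 / 2 + Λ ^ 2) * ‖e t‖ ^ 2 - σ * ‖μ t‖ ^ 2 / 2) :=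
      mul_le_mul_of_nonneg_left (by linarith) hε.le
    have h6 := mul_le_mul_of_nonneg_right hε1 (sq_nonneg ‖e t‖)
    have h7 : c * W t ≤ c * (‖e t‖ ^ 2 + ‖μ t‖ ^ 2) :=
      mul_le_mul_of_nonneg_left (hWbd t).2 hc0.le
    have h8 := mul_le_mul_of_nonneg_right (min_le_left (ω / 2) (ε * σ / 2)) (sq_nonneg ‖e t‖)
    have h9 := mul_le_mul_of_nonneg_right (min_le_right (ω / 2) (ε * σ / 2)) (sq_nonneg ‖μ t‖)
    rw [← hc] at h8 h9
    simp only [he] at h1 h5 h6 h7 h8 h9 ⊢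
    linarith
  refine ⟨√(4 * W 0), fun t ht => ?_⟩
  have h1 := le_mul_exp_of_deriv_right_le hWd hWle ht
  have h2 := (hWbd t).1
  have h3 : ‖e t‖ ^ 2 ≤ 4 * W 0 * Real.exp (-c * t) := by nlinarith [sq_nonneg ‖μ t‖]
  refine (Real.le_sqrt_of_sq_le h3).trans ?_
  rw [Real.sqrt_mul' _ (Real.exp_pos _).le, Real.sqrt_eq_rpow (Real.exp _), ← Real.exp_mul]
  refine le_of_eq ?_
  ring_nf

end SaddleFlow

/-! ### The Laplacian: symmetry, kernel and range. -/

namespace WeightedGraph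

variable {N : ℕ} {F : Type*} [NormedAddCommGroup F] [InnerProductSpace ℝ F]
  [FiniteDimensional ℝ F]

/-- The Laplacian of a weighted graph, acting on stacked vectors. -/
noncomputable def laplacian (G : WeightedGraph (Fin N)) :
    PiLp 2 (fun _ : Fin N => F) →L[ℝ]
      PiLp 2 (fun _ : Fin N => F) :=
  LinearMap.toContinuousLinearMap
    { toFun := fun x => WithLp.toLp 2 fun i => ∑ j, G.a i j • (x i - x j)
      map_add' := fun x y => by
        refine PiLp.ext fun i => ?_
        simp only [PiLp.add_apply, ← Finset.sum_add_distrib]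
        exact Finset.sum_congr rfl fun j _ => by module
      map_smul' := fun c x => by
        refine PiLp.ext fun i => ?_
        simp only [PiLp.smul_apply, RingHom.id_apply, Finset.smul_sum]
        exact Finset.sum_congr rfl fun j _ => by module }

variable (G : WeightedGraph (Fin N))

theorem laplacian_apply (x : PiLp 2 (fun _ : Fin N => F)) (i : Fin N) :
    G.laplacian x i = ∑ j, G.a i j • (x i - x j) := rfl

/-- Average the double sum with its copy under exchange of `i` and `j`. Symmetry and the kernel both
follow from this form. -/
theorem two_mul_inner_laplacian (x y : PiLp 2 (fun _ : Fin N => F)) :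
    2 * inner ℝ (G.laplacian x) y =
      ∑ i, ∑ j, G.a i j * inner ℝ (x i - x j) (y i - y j) := by
  have h1 : inner ℝ (G.laplacian x) y = ∑ i, ∑ j, G.a i j * inner ℝ (x i - x j) (y i) := by
    simp only [PiLp.inner_apply, laplacian_apply, sum_inner, real_inner_smul_left]
  have h2 : inner ℝ (G.laplacian x) y = ∑ i, ∑ j, G.a i j * -inner ℝ (x i - x j) (y j) := by
    rw [h1, Finset.sum_comm]
    refine Finset.sum_congr rfl fun i _ => Finset.sum_congr rfl fun j _ => ?_
    rw [G.symm j i, ← neg_sub (x i), inner_neg_left]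
  rw [two_mul]
  nth_rewrite 1 [h1]
  rw [h2]
  simp only [← Finset.sum_add_distrib, inner_sub_right]
  exact Finset.sum_congr rfl fun i _ => Finset.sum_congr rfl fun j _ => by ring

theorem inner_laplacian_comm (x y : PiLp 2 (fun _ : Fin N => F)) :
    inner ℝ (G.laplacian x) y = inner ℝ x (G.laplacian y) := by
  have h1 := G.two_mul_inner_laplacian x y
  have h2 := G.two_mul_inner_laplacian y x
  rw [real_inner_comm] at h2
  have : ∀ i j, inner ℝ (x i - x j) (y i - y j) = inner ℝ (y i - y j) (x i - x j) :=
    fun i j => real_inner_comm _ _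
  simp only [this] at h1
  linarith

variable {G}

theorem eq_of_laplacian_eq_zero (hG : G.graph.Connected)
    {x : PiLp 2 (fun _ : Fin N => F)} (hx : G.laplacian x = 0)
    (i j : Fin N) : x i = x j := by
  have h := G.two_mul_inner_laplacian x x
  rw [hx, inner_zero_left, mul_zero] at h
  have hnn : ∀ i j, 0 ≤ G.a i j * inner ℝ (x i - x j) (x i - x j) := fun i j =>
    mul_nonneg (G.nonneg i j) real_inner_self_nonneg
  have hadj : ∀ i j, G.graph.Adj i j → x i = x j := fun i j hij => by
    have h1 := (Finset.sum_eq_zero_iff_of_nonneg fun i _ =>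
      Finset.sum_nonneg fun j _ => hnn i j).1 h.symm i (Finset.mem_univ i)
    have h2 := (Finset.sum_eq_zero_iff_of_nonneg fun j _ => hnn i j).1 h1 j (Finset.mem_univ j)
    exact sub_eq_zero.1 (inner_self_eq_zero.1
      ((mul_eq_zero.1 h2).resolve_left ((G.pos_iff_adj i j).2 hij).ne'))
  obtain ⟨p⟩ := hG.preconnected i j
  induction p with
  | nil => rfl
  | cons h _ ih => exact (hadj _ _ h).trans ih

/-- The range of the Laplacian of a connected graph is the space of zero-sum vectors. -/
theorem exists_laplacian_eq_of_sum_eq_zero (hG : G.graph.Connected)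
    {y : PiLp 2 (fun _ : Fin N => F)} (hy : ∑ i, y i = 0) :
    ∃ x, G.laplacian x = y := by
  have hsymm : (G.laplacian (F := F)).toLinearMap.IsSymmetric := G.inner_laplacian_comm
  have : y ∈ (G.laplacian (F := F)).toLinearMap.range := by
    -- The orthogonal complement of the range is the kernel, made of constant vectors; pairing one
    -- with `y` only sees the sum of `y`.
    rw [← Submodule.orthogonal_orthogonal (G.laplacian (F := F)).toLinearMap.range,
      hsymm.orthogonal_range, Submodule.mem_orthogonal]
    intro k hk
    obtain ⟨i₀⟩ := hG.nonempty
    have hk' : ∀ i, k i = k i₀ := fun i => eq_of_laplacian_eq_zero hG hk i i₀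
    simp only [PiLp.inner_apply, hk', ← inner_sum, hy, inner_zero_right]
  exact this

end WeightedGraph

/-! ### Stationarity, stacked gradients and passage between nodes and stacked vectors. -/

theorem sum_gradient_eq_zero_of_isMinOn {ι E : Type*} [Fintype ι] [NormedAddCommGroup E]
    [InnerProductSpace ℝ E] [CompleteSpace E] {f : ι → E → ℝ}
    (hdiff : ∀ i, Differentiable ℝ (f i)) {y : E}
    (hmin : IsMinOn (fun y => ∑ i, f i y) Set.univ y) : ∑ i, gradient (f i) y = 0 := by
  have h1 : HasFDerivAt (fun y => ∑ i, f i y)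
      (∑ i, InnerProductSpace.toDual ℝ E (gradient (f i) y)) y :=
    HasFDerivAt.fun_sum fun i _ => (hdiff i y).hasGradientAt.hasFDerivAt
  have h2 := (hmin.isLocalMin univ_mem).hasFDerivAt_eq_zero h1
  rw [← map_sum] at h2
  exact (map_eq_zero_iff _ (InnerProductSpace.toDual ℝ E).injective).1 h2

section StackedGradient

variable {ι F : Type*} [NormedAddCommGroup F] [InnerProductSpace ℝ F] [CompleteSpace F]

/-- The gradients of the `f i`, each at its own component, as one vector field. -/
noncomputable def stackedGradient (f : ι → F → ℝ) (x : PiLp 2 (fun _ : ι => F)) :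
    PiLp 2 (fun _ : ι => F) :=
  WithLp.toLp 2 fun i => gradient (f i) (x i)

variable {f : ι → F → ℝ}

theorem continuous_stackedGradient (h : ∀ i, Continuous (gradient (f i))) :
    Continuous (stackedGradient f) :=
  (PiLp.continuous_toLp 2 _).comp <| continuous_pi fun i =>
    (h i).comp (PiLp.proj 2 (𝕜 := ℝ) (fun _ : ι => F) i).continuous

variable [Fintype ι]

theorem inner_stackedGradient_sub (x y : PiLp 2 (fun _ : ι => F)) :
    inner ℝ (stackedGradient f x - stackedGradient f y) (x - y) =
      ∑ i, inner ℝ (gradient (f i) (x i) - gradient (f i) (y i)) (x i - y i) := by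
  rw [PiLp.inner_apply]
  rfl

theorem inner_stackedGradient_pos (hconv : ∀ i, StrictConvexOn ℝ Set.univ (f i))
    (hdiff : ∀ i, Differentiable ℝ (f i)) {x y : PiLp 2 (fun _ : ι => F)} (hxy : x ≠ y) :
    0 < inner ℝ (stackedGradient f x - stackedGradient f y) (x - y) := by
  rw [inner_stackedGradient_sub]
  obtain ⟨i, hi⟩ : ∃ i, x i ≠ y i := by
    by_contra! h
    exact hxy (PiLp.ext h)
  exact Finset.sum_pos'
    (fun i _ => (hconv i).convexOn.inner_gradient_nonneg (hdiff i) _ _)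
    ⟨i, Finset.mem_univ i, (hconv i).inner_gradient_pos (hdiff i) hi⟩

theorem mul_norm_sq_le_inner_stackedGradient {ω : ℝ}
    (hconv : ∀ i, StrongConvexOn Set.univ ω (f i))
    (hdiff : ∀ i, Differentiable ℝ (f i)) (x y : PiLp 2 (fun _ : ι => F)) :
    ω * ‖x - y‖ ^ 2 ≤ inner ℝ (stackedGradient f x - stackedGradient f y) (x - y) := by
  rw [inner_stackedGradient_sub, PiLp.norm_sq_eq_of_L2, Finset.mul_sum]
  exact Finset.sum_le_sum fun i _ =>
    (hconv i).mul_norm_sq_le_inner_gradient (hdiff i) (x i) (y i)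

theorem norm_stackedGradient_sub_le {ϑ : ℝ≥0} (hlip : ∀ i, LipschitzWith ϑ (gradient (f i)))
    (x y : PiLp 2 (fun _ : ι => F)) :
    ‖stackedGradient f x - stackedGradient f y‖ ≤ ϑ * ‖x - y‖ := by
  refine (abs_le_of_sq_le_sq' ?_ (by positivity)).2
  rw [mul_pow, PiLp.norm_sq_eq_of_L2, PiLp.norm_sq_eq_of_L2, Finset.mul_sum]
  refine Finset.sum_le_sum fun i _ => ?_
  rw [← mul_pow]
  exact pow_le_pow_left₀ (norm_nonneg _) ((hlip i).norm_sub_le (x i) (y i)) 2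

end StackedGradient

/-- A minimizer of `∑ i, f i`, repeated at every node, is an equilibrium with suitable dual
variables. -/
theorem WeightedGraph.exists_equilibrium {N : ℕ} {F : Type*} [NormedAddCommGroup F]
    [InnerProductSpace ℝ F] [FiniteDimensional ℝ F] [CompleteSpace F]
    {G : WeightedGraph (Fin N)} (hG : G.graph.Connected) {f : Fin N → F → ℝ}
    (hdiff : ∀ i, Differentiable ℝ (f i)) {y : F}
    (hmin : IsMinOn (fun y => ∑ i, f i y) Set.univ y) :
    G.laplacian (WithLp.toLp 2 fun _ => y) = 0 ∧
      ∃ ls, stackedGradient f (WithLp.toLp 2 fun _ => y) + G.laplacian ls = 0 := by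
  constructor
  · refine PiLp.ext fun i => ?_
    simp [WeightedGraph.laplacian_apply]
  · obtain ⟨ls, hls⟩ := WeightedGraph.exists_laplacian_eq_of_sum_eq_zero hG
      (y := -stackedGradient f (WithLp.toLp 2 fun _ => y)) (by
        have : ∑ i, -gradient (f i) y = 0 := by
          rw [Finset.sum_neg_distrib, sum_gradient_eq_zero_of_isMinOn hdiff hmin, neg_zero]
        exact this)
    exact ⟨ls, by rw [hls, add_neg_cancel]⟩

theorem hasDerivWithinAt_toLp {ι F : Type*} [Fintype ι] [NormedAddCommGroup F] [NormedSpace ℝ F]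
    {x : ℝ → ι → F} {v : ι → F} {s : Set ℝ} {t : ℝ}
    (h : ∀ i, HasDerivWithinAt (fun t => x t i) (v i) s t) :
    HasDerivWithinAt (fun t => WithLp.toLp 2 (x t)) (WithLp.toLp 2 v) s t :=
  (PiLp.continuousLinearEquiv 2 ℝ (fun _ : ι => F)).symm.hasFDerivAt.comp_hasDerivWithinAt t
    (hasDerivWithinAt_pi.2 h)

theorem hasDerivWithinAt_apply_of_piLp {ι F : Type*} [Fintype ι] [NormedAddCommGroup F]
    [NormedSpace ℝ F] {x : ℝ → PiLp 2 (fun _ : ι => F)} {v : PiLp 2 (fun _ : ι => F)}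
    {s : Set ℝ} {t : ℝ} (h : HasDerivWithinAt x v s t) (i : ι) :
    HasDerivWithinAt (fun t => x t i) (v i) s t :=
  (PiLp.proj 2 (𝕜 := ℝ) (fun _ : ι => F) i).hasFDerivAt.comp_hasDerivWithinAt t h

section Trajectory

variable {N : ℕ} {F : Type*} [NormedAddCommGroup F] [InnerProductSpace ℝ F]
  [FiniteDimensional ℝ F] {G : WeightedGraph (Fin N)} {z lam : ℝ → Fin N → F}
  {s : Set ℝ} {t : ℝ}

theorem WeightedGraph.hasDerivWithinAt_toLp_primal [CompleteSpace F] {f : Fin N → F → ℝ}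
    (h : ∀ i, HasDerivWithinAt (fun s => z s i)
      (-gradient (f i) (z t i) - ∑ j, G.a i j • (lam t i - lam t j)) s t) :
    HasDerivWithinAt (fun t => (WithLp.toLp 2 (z t) : PiLp 2 (fun _ : Fin N => F)))
      (-stackedGradient f (WithLp.toLp 2 (z t)) - G.laplacian (WithLp.toLp 2 (lam t))) s t :=
  hasDerivWithinAt_toLp h

theorem WeightedGraph.hasDerivWithinAt_toLp_dual
    (h : ∀ i, HasDerivWithinAt (fun s => lam s i) (∑ j, G.a i j • (z t i - z t j)) s t) :
    HasDerivWithinAt (fun t => (WithLp.toLp 2 (lam t) : PiLp 2 (fun _ : Fin N => F)))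
      (G.laplacian (WithLp.toLp 2 (z t))) s t :=
  hasDerivWithinAt_toLp h

end Trajectory

/-! ### The network dynamics as an instance of the saddle flow. -/

theorem mainTheorem7 {N m : ℕ} (G : WeightedGraph (Fin N)) (hG : G.graph.Connected)
    (f : Fin N → EuclideanSpace ℝ (Fin m) → ℝ)
    (hdiff : ∀ i, Differentiable ℝ (f i))
    (hconv : ∀ i, StrictConvexOn ℝ Set.univ (f i))
    (ystar : EuclideanSpace ℝ (Fin m))
    (hmin : IsMinOn (fun y => ∑ i, f i y) Set.univ ystar) :
    (∀ z₀ lam₀ : Fin N → EuclideanSpace ℝ (Fin m),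
      ∃ z lam : ℝ → Fin N → EuclideanSpace ℝ (Fin m),
        IsPrimalDualTrajectory G f z lam ∧ z 0 = z₀ ∧ lam 0 = lam₀) ∧
    (∀ z lam : ℝ → Fin N → EuclideanSpace ℝ (Fin m), IsPrimalDualTrajectory G f z lam →
      (∃ C : ℝ, ∀ t : ℝ, 0 ≤ t → ∀ i, ‖z t i‖ ≤ C ∧ ‖lam t i‖ ≤ C) ∧
      ∀ i, Tendsto (fun t => z t i) atTop (𝓝 ystar)) ∧
    ((∃ ω : ℝ, 0 < ω ∧ ∃ ϑ : ℝ≥0, 0 < ϑ ∧ ∀ i,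
        StrongConvexOn Set.univ ω (f i) ∧ LipschitzWith ϑ (gradient (f i))) →
      ∃ γ : ℝ, 0 < γ ∧
        ∀ z lam : ℝ → Fin N → EuclideanSpace ℝ (Fin m), IsPrimalDualTrajectory G f z lam →
          ∃ C : ℝ, ∀ t : ℝ, 0 ≤ t → ∀ i, ‖z t i - ystar‖ ≤ C * Real.exp (-γ * t)) := by
  have hL := G.inner_laplacian_comm (F := EuclideanSpace ℝ (Fin m))
  obtain ⟨hz, ls, hl⟩ := WeightedGraph.exists_equilibrium hG hdiff hmin
  have hgc := continuous_stackedGradient fun i =>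
    (hconv i).convexOn.continuous_gradient (hdiff i)
  refine ⟨fun z₀ lam₀ => ?_, fun z lam h => ?_, ?_⟩
  · obtain ⟨z, l, hz0, hl0, hzd, hld⟩ := exists_saddle_trajectory hgc
      (fun x y => by
        rw [inner_stackedGradient_sub]
        exact Finset.sum_nonneg fun i _ =>
          (hconv i).convexOn.inner_gradient_nonneg (hdiff i) _ _)
      hL hz hl (WithLp.toLp 2 z₀) (WithLp.toLp 2 lam₀)
    exact ⟨fun t => (z t).ofLp, fun t => (l t).ofLp,
      ⟨fun t ht i => hasDerivWithinAt_apply_of_piLp (hzd t ht) i,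
        fun t ht i => hasDerivWithinAt_apply_of_piLp (hld t ht) i⟩,
      congrArg WithLp.ofLp hz0, congrArg WithLp.ofLp hl0⟩
  · obtain ⟨⟨C, hC⟩, hlim⟩ := saddle_trajectory_bounded_and_tendsto hgc
      (fun x y hxy => inner_stackedGradient_pos hconv hdiff hxy) hL hz hl
      (fun t ht => WeightedGraph.hasDerivWithinAt_toLp_primal (h.primal t ht)) (fun t ht => WeightedGraph.hasDerivWithinAt_toLp_dual (h.dual t ht))
    refine ⟨⟨C, fun t ht i => ⟨?_, ?_⟩⟩, fun i => ?_⟩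
    · exact (PiLp.norm_apply_le (WithLp.toLp 2 (z t)) i).trans (hC t ht).1
    · exact (PiLp.norm_apply_le (WithLp.toLp 2 (lam t)) i).trans (hC t ht).2
    · exact ((PiLp.proj 2 (𝕜 := ℝ) (fun _ : Fin N =>
        EuclideanSpace ℝ (Fin m)) i).continuous.tendsto _).comp hlim
  · rintro ⟨ω, hω, ϑ, -, hf⟩
    obtain ⟨γ, hγ, hdecay⟩ := saddle_trajectory_exp_decay hL hz hl hω
      (mul_norm_sq_le_inner_stackedGradient (fun i => (hf i).1) hdiff)
      (norm_stackedGradient_sub_le fun i => (hf i).2)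
    refine ⟨γ, hγ, fun z lam h => ?_⟩
    obtain ⟨C, hC⟩ := hdecay _ _ (fun t ht => WeightedGraph.hasDerivWithinAt_toLp_primal (h.primal t ht)) (fun t ht => WeightedGraph.hasDerivWithinAt_toLp_dual (h.dual t ht))
    exact ⟨C, fun t ht i => (PiLp.norm_apply_le
      (WithLp.toLp 2 (z t) - WithLp.toLp 2 fun _ => ystar) i).trans (hC t ht)⟩
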